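/- Let $p$ be a prime, $N\ge 1$, and let $L_0=\mathbb{Q}_p\{\{t_N\}\}\dots\{\{t_2\}\}$ be the basic $N$-dimensional local field, with first residue field $\mathbb{F}_p((t_N))\dots((t_2))$. Here, for a complete discretely valued field $E$, $E\{\{t\}\}$ is the field of series $\sum_{n\in\mathbb{Z}}a_nt^n$ with bounded coefficients $a_n\in E$ such that $a_n\to 0$ as $n\to-\infty$. Let $\mathbb{C}(N)_p$ be the completion of an algebraic closure of $L_0$ with respect to the first ($p$-adic) valuation, and let $\mathcal{O}_{\mathbb{C}(N)_p}=\{o : v(o)\ge 0\}$ be its valuation ring for the extension $v$ of the canonical valuation of rank $N$ of $L_0$ (the unique extension to the algebraic closure, extended to the completion by continuity). Put $R(N)=\varprojlim_{x\mapsto x^p}\mathcal{O}_{\mathbb{C}(N)_p}/p$, and let $R_0(N)$ be the fraction field of $R(N)$. Let $\operatorname{Aut}\mathbb{C}(N)_p$ be the group of field automorphisms $f$ of $\mathbb{C}(N)_p$ with $f(\mathcal{O}_{\mathbb{C}(N)_p})=\mathcal{O}_{\mathbb{C}(N)_p}$, and let $\operatorname{Aut}R_0(N)$ be the group of field automorphisms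 $g$ of $R_0(N)$ with $g(R(N))=R(N)$. For $f\in\operatorname{Aut}\mathbb{C}(N)_p$ let $f_R\in\operatorname{Aut}R_0(N)$ be the automorphism induced by $(r_n \bmod p)_{n\ge 0}\mapsto (f(r_n)\bmod p)_{n\ge 0}$ on $R(N)$. Let $\varepsilon=(\varepsilon^{(n)}\bmod p)_{n\ge 0}\in R(N)$ be a Fontaine element, i.e. $\varepsilon^{(n)}\in\mathbb{C}(N)_p$, $\varepsilon^{(0)}=1$, $\varepsilon^{(1)}\ne 1$ and $(\varepsilon^{(n+1)})^p=\varepsilon^{(n)}$ for all $n\ge 0$, and let $\langle\varepsilon\rangle=\varepsilon^{\mathbb{Z}_p}=\{((\varepsilon^{(n)})^a\bmod p)_{n\ge 0} : a\in\mathbb{Z}_p\}$. Then $f\mapsto f_R$ is an injective group homomorphism from $\operatorname{Aut}\mathbb{C}(N)_p$ to $\operatorname{Aut}R_0(N)$, and its image is exactly the subgroup $\operatorname{Aut}'R_0(N)=\{g\in\operatorname{Aut}R_0(N) : g(\langle\varepsilon\rangle)=\langle\varepsilon\rangle\}$. -/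

import Mathlib

set_option linter.unusedSectionVars false

noncomputable section
namespace HigherLocal

variable (p : ℕ)

/-- The ring of integers (for the first, `p`-adic valuation) `O` of a complete discretely valued
field of characteristic `0` with prime element `p`, together with the reduction map
`α : O → k` onto its residue field and a subring `V` of `k` (the full valuation ring of `k`,
seen as a higher dimensional local field). The last four fields are properties which are proved
along the recursive construction below; they say that `O` is a complete discrete valuation ring
with prime element `p` and that `α` is its reduction map. -/
structure Stage where
  O : Type
  [ringO : CommRing O]
  k : Type
  [fieldK : Field k]
  α : O →+* k
  V : Subring k
  α_surjective : Function.Surjective α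
  α_eq_zero_iff : ∀ x : O, α x = 0 ↔ (p : O) ∣ x
  regular : ∀ x : O, (p : O) * x = 0 → x = 0
  complete : IsAdicComplete (Ideal.span {(p : O)}) O

attribute [instance] Stage.ringO Stage.fieldK

/-- The ring `ℤ_p` with residue field `𝔽_p` (a zero dimensional local field, `V = 𝔽_p`). -/
def Stage.base [Fact p.Prime] : Stage p where
  O := ℤ_[p]
  k := ZMod p
  α := PadicInt.toZMod
  V := ⊤
  α_surjective := ZMod.ringHom_surjective _
  α_eq_zero_iff x := by
    rw [← RingHom.mem_ker, PadicInt.ker_toZMod, PadicInt.maximalIdeal_eq_span_p,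
      Ideal.mem_span_singleton]
  regular x hx := by
    have := (Fact.out : p.Prime).ne_zero
    simpa [this] using hx
  complete := by
    rw [← PadicInt.maximalIdeal_eq_span_p]; infer_instance

/-- The homomorphism `R((t)) → S((t))` which applies `f` to all coefficients. -/
def laurentMap {R S : Type} [CommRing R] [CommRing S] (f : R →+* S) :
    LaurentSeries R →+* LaurentSeries S where
  toFun x := HahnSeries.map x f
  map_one' := by
    ext n; simp [HahnSeries.coeff_one, apply_ite f]
  map_mul' x y := HahnSeries.map_mul (f : R →ₙ+* S)
  map_zero' := by ext n; simp
  map_add' x y := by ext n; simp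

/-- The valuation ring of the higher dimensional local field `k((t))` when `V` is the one of `k`:
the preimage of `V` under the residue map `k[[t]] → k`, that is `V + t k[[t]]`. -/
def laurentValRing {k : Type} [Field k] (V : Subring k) : Subring (LaurentSeries k) where
  carrier := {f | (∀ n < 0, f.coeff n = 0) ∧ f.coeff 0 ∈ V}
  zero_mem' := by simp [V.zero_mem]
  one_mem' := ⟨fun n hn => by simp [HahnSeries.coeff_one, hn.ne], by simp [V.one_mem]⟩
  add_mem' {f g} hf hg := ⟨fun n hn => by simp [hf.1 n hn, hg.1 n hn], by
    simpa using V.add_mem hf.2 hg.2⟩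
  neg_mem' {f} hf := ⟨fun n hn => by simp [hf.1 n hn], by simpa using V.neg_mem hf.2⟩
  mul_mem' {f g} hf hg := by
    constructor
    · intro n hn
      rw [HahnSeries.coeff_mul]
      refine Finset.sum_eq_zero fun ij hij => ?_
      rw [Finset.mem_antidiagonal] at hij
      rcases lt_or_ge ij.1 0 with h | h
      · rw [hf.1 _ h, zero_mul]
      · rw [hg.1 _ (by omega), mul_zero]
    · rw [HahnSeries.coeff_mul]
      refine V.sum_mem fun ij hij => ?_
      rw [Finset.mem_antidiagonal] at hij
      rcases lt_or_ge ij.1 0 with h | h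
      · rw [hf.1 _ h, zero_mul]; exact V.zero_mem
      · rcases h.eq_or_lt with h | h
        · have h2 : ij.2 = 0 := by omega
          rw [← h, h2]; exact V.mul_mem hf.2 hg.2
        · rw [hg.1 _ (by omega), mul_zero]; exact V.zero_mem

lemma coeff_natCast_mul {R : Type} [CommRing R] (m : ℕ) (f : LaurentSeries R) (n : ℤ) :
    ((m : LaurentSeries R) * f).coeff n = (m : R) * f.coeff n := by
  rw [← nsmul_eq_mul, ← nsmul_eq_mul, HahnSeries.coeff_nsmul, Pi.smul_apply]

variable {p}

lemma laurentMap_eq_zero_iff (S : Stage p) (f : LaurentSeries S.O) :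
    laurentMap S.α f = 0 ↔ (p : LaurentSeries S.O) ∣ f := by
  constructor
  · intro h
    have h1 : ∀ n, (p : S.O) ∣ f.coeff n := fun n => by
      rw [← S.α_eq_zero_iff]
      exact congrArg (fun g => HahnSeries.coeff g n) h
    classical
    choose c hc using h1
    refine ⟨⟨fun n => if f.coeff n = 0 then 0 else c n, f.isPWO_support.mono fun n hn => ?_⟩, ?_⟩
    · intro h0; exact hn (by simp [h0])
    · ext n
      rw [coeff_natCast_mul]
      by_cases h0 : f.coeff n = 0
      · simp [h0]
      · simp only [h0, if_false]; exact hc n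
  · rintro ⟨g, rfl⟩
    ext n
    change S.α ((_ : LaurentSeries S.O).coeff n) = 0
    rw [coeff_natCast_mul]
    exact (S.α_eq_zero_iff _).2 (dvd_mul_right _ _)

lemma laurentMap_surjective {R S : Type} [CommRing R] [CommRing S] (f : R →+* S)
    (hf : Function.Surjective f) : Function.Surjective (laurentMap f) := by
  classical
  intro g
  choose c hc using hf
  refine ⟨⟨fun n => if g.coeff n = 0 then 0 else c (g.coeff n),
    g.isPWO_support.mono fun n hn => ?_⟩, ?_⟩
  · intro h0; exact hn (by simp [h0])
  · ext n
    change f (if g.coeff n = 0 then 0 else c (g.coeff n)) = g.coeff n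
    by_cases h0 : g.coeff n = 0
    · simp [h0]
    · simp [h0, hc]

/-- The `p`-adic completion of a ring. -/
abbrev pCompletion (p : ℕ) (A : Type) [CommRing A] : Type := AdicCompletion (Ideal.span {(p : A)}) A

lemma span_p_fg (A : Type) [CommRing A] : (Ideal.span {(p : A)}).FG := ⟨{(p : A)}, by simp⟩

lemma map_span_p (A B : Type) [CommRing A] [CommRing B] [Algebra A B] :
    (Ideal.span {(p : A)}).map (algebraMap A B) = Ideal.span {(p : B)} := by
  simp [Ideal.map_span]

/-- The projection from the `p`-adic completion of `A` to `A / p`. -/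
def pCompletionToQuot (A : Type) [CommRing A] :
    pCompletion p A →+* A ⧸ Ideal.span {(p : A)} :=
  (AdicCompletion.evalOneₐ (Ideal.span {(p : A)})).toRingHom

lemma pCompletionToQuot_eq_zero_iff (A : Type) [CommRing A] (x : pCompletion p A) :
    pCompletionToQuot A x = 0 ↔ (p : pCompletion p A) ∣ x := by
  rw [← RingHom.mem_ker, pCompletionToQuot, AdicCompletion.ker_evalOneₐ_eq_map _ (span_p_fg A),
    map_span_p, Ideal.mem_span_singleton]

lemma pCompletion_regular (A : Type) [CommRing A] (hA : ∀ x : A, (p : A) * x = 0 → x = 0)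
    (x : pCompletion p A) (hx : (p : pCompletion p A) * x = 0) : x = 0 := by
  apply AdicCompletion.ext_evalₐ
  intro n
  obtain ⟨a, ha⟩ := Ideal.Quotient.mk_surjective
    (AdicCompletion.evalₐ (Ideal.span {(p : A)}) (n + 1) x)
  have h1 : (Ideal.Quotient.mk (Ideal.span {(p : A)} ^ (n + 1))) ((p : A) * a) = 0 := by
    rw [map_mul, ha, map_natCast,
      ← map_natCast (AdicCompletion.evalₐ (Ideal.span {(p : A)}) (n + 1)), ← map_mul, hx, map_zero]
  rw [Ideal.Quotient.eq_zero_iff_mem, Ideal.span_singleton_pow, Ideal.mem_span_singleton] at h1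
  obtain ⟨b, hb⟩ := h1
  have h2 : a = (p : A) ^ n * b := by
    rw [← sub_eq_zero]; apply hA
    rw [mul_sub, hb]; ring
  have h3 : AdicCompletion.evalₐ (Ideal.span {(p : A)}) n x =
      Ideal.Quotient.mk (Ideal.span {(p : A)} ^ n) a := by
    induction x using AdicCompletion.induction_on with
    | _ f =>
    rw [AdicCompletion.evalₐ_mk] at ha ⊢
    have h4 := congrArg (Ideal.Quotient.factorPow (Ideal.span {(p : A)}) (Nat.le_succ n)) ha
    simp only [Nat.succ_eq_add_one, Ideal.Quotient.factor_mk] at h4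
    rw [h4]
    exact (AdicCompletion.Ideal.mk_eq_mk _ (Nat.le_succ n) f).symm
  rw [h3, map_zero, h2, Ideal.Quotient.eq_zero_iff_mem, Ideal.span_singleton_pow,
    Ideal.mem_span_singleton]
  exact dvd_mul_right _ _

/-- Passage from `E` to `E{{t}}` on the level of rings of integers. The ring of integers of `E{{t}}`
consists of the series `∑ aₙ tⁿ` (`n ∈ ℤ`, `aₙ ∈ O_E`) with `aₙ → 0` for `n → -∞`, so it is the
`p`-adic completion of `O_E((t))`. Its residue field is `k((t))`, and the reduction map applies `α`
to the coefficients. -/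
def Stage.next (S : Stage p) : Stage p where
  O := pCompletion p (LaurentSeries S.O)
  k := LaurentSeries S.k
  α := (Ideal.Quotient.lift (Ideal.span {(p : LaurentSeries S.O)}) (laurentMap S.α) (fun f hf =>
      (laurentMap_eq_zero_iff S f).2 (Ideal.mem_span_singleton.1 hf))).comp
    (pCompletionToQuot (LaurentSeries S.O))
  V := laurentValRing S.V
  α_surjective := by
    rw [RingHom.coe_comp]
    exact (Ideal.Quotient.lift_surjective_of_surjective _ _
      (laurentMap_surjective _ S.α_surjective)).comp (AdicCompletion.evalOneₐ_surjective _)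
  α_eq_zero_iff x := by
    rw [← pCompletionToQuot_eq_zero_iff, RingHom.comp_apply]
    obtain ⟨a, ha⟩ := Ideal.Quotient.mk_surjective (pCompletionToQuot (LaurentSeries S.O) x)
    rw [← ha, Ideal.Quotient.lift_mk, laurentMap_eq_zero_iff, Ideal.Quotient.eq_zero_iff_mem,
      Ideal.mem_span_singleton]
  regular := pCompletion_regular _ fun f hf => by
    ext n
    apply S.regular
    rw [← coeff_natCast_mul, hf, HahnSeries.coeff_zero]
  complete := by
    have h := map_span_p (p := p) (LaurentSeries S.O) (pCompletion p (LaurentSeries S.O))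
    exact h ▸ (IsAdicComplete.map_algebraMap_iff _ _).2
      (AdicCompletion.isAdicComplete (span_p_fg (LaurentSeries S.O)))

lemma Stage.nontrivial (S : Stage p) : Nontrivial S.O := S.α.domain_nontrivial

lemma Stage.isUnit_of (S : Stage p) {x : S.O} (hx : S.α x ≠ 0) : IsUnit x := by
  have := S.complete
  obtain ⟨y, hy⟩ := S.α_surjective (S.α x)⁻¹
  have h1 : S.α (x * y - 1) = 0 := by simp [hy, hx]
  have h2 : x * y - 1 ∈ Ideal.jacobson (⊥ : Ideal S.O) :=
    IsAdicComplete.le_jacobson_bot (Ideal.span {(p : S.O)})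
      (Ideal.mem_span_singleton.2 ((S.α_eq_zero_iff _).1 h1))
  have h3 := Ideal.mem_jacobson_bot.1 h2 1
  rw [mul_one, sub_add_cancel] at h3
  exact isUnit_of_mul_isUnit_left h3

lemma Stage.exists_unit_mul_pow (S : Stage p) {x : S.O} (hx : x ≠ 0) :
    ∃ (n : ℕ) (u : S.Oˣ), x = (p : S.O) ^ n * u := by
  have := S.complete
  by_contra! H
  apply hx
  apply IsHausdorff.haus (I := Ideal.span {(p : S.O)}) inferInstance
  intro n
  rw [SModEq.zero, smul_eq_mul, Ideal.mul_top, Ideal.span_singleton_pow, Ideal.mem_span_singleton]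
  induction n with
  | zero => simp
  | succ n ih =>
    obtain ⟨y, rfl⟩ := ih
    by_cases hy : S.α y = 0
    · obtain ⟨z, rfl⟩ := (S.α_eq_zero_iff y).1 hy
      exact ⟨z, by ring⟩
    · obtain ⟨u, rfl⟩ := S.isUnit_of hy
      exact absurd rfl (H n u)

lemma Stage.not_isUnit (S : Stage p) : ¬ IsUnit (p : S.O) := fun h =>
  (h.map S.α).ne_zero ((S.α_eq_zero_iff _).2 dvd_rfl)

lemma Stage.pow_regular (S : Stage p) (n : ℕ) (x : S.O) (h : (p : S.O) ^ n * x = 0) : x = 0 := by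
  induction n with
  | zero => simpa using h
  | succ n ih => exact ih (S.regular _ (by rw [← h]; ring))

instance Stage.isDomain (S : Stage p) : IsDomain S.O := by
  have := S.nontrivial
  have : NoZeroDivisors S.O := ⟨fun {x y} hxy => by
    by_contra! H
    obtain ⟨n, u, rfl⟩ := S.exists_unit_mul_pow H.1
    apply H.2
    rw [mul_assoc] at hxy
    have := S.pow_regular _ _ hxy
    simpa using this⟩
  exact NoZeroDivisors.to_isDomain _

lemma Stage.irreducible_p (S : Stage p) : Irreducible (p : S.O) := by
  refine ⟨S.not_isUnit, fun a b hab => ?_⟩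
  by_contra! H
  have ha : S.α a = 0 := by by_contra h; exact H.1 (S.isUnit_of h)
  have hb : S.α b = 0 := by by_contra h; exact H.2 (S.isUnit_of h)
  obtain ⟨c, rfl⟩ := (S.α_eq_zero_iff a).1 ha
  obtain ⟨e, rfl⟩ := (S.α_eq_zero_iff b).1 hb
  have h0 : (p : S.O) * (1 - p * (c * e)) = 0 := by rw [mul_sub, ← sub_eq_zero.2 hab]; ring
  have h1 := S.regular _ h0
  exact S.not_isUnit (IsUnit.of_mul_eq_one _ (sub_eq_zero.1 h1).symm)

instance Stage.isDVR (S : Stage p) : IsDiscreteValuationRing S.O :=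
  IsDiscreteValuationRing.ofHasUnitMulPowIrreducibleFactorization
    ⟨p, S.irreducible_p, fun {x} hx => by
      obtain ⟨n, u, rfl⟩ := S.exists_unit_mul_pow hx
      exact ⟨n, u, rfl⟩⟩

/-- The ring of integers of `ℚ_p{{t_N}}…{{t_2}}`, with `N = d + 1`, together with its residue field
`𝔽_p((t_N))…((t_2))`. -/
def stage (p : ℕ) [Fact p.Prime] : ℕ → Stage p
  | 0 => Stage.base p
  | d + 1 => (stage p d).next


section Field
variable (p) [Fact p.Prime] (d : ℕ)

/-- The `N`-dimensional local field `L₀ = ℚ_p{{t_N}}…{{t_2}}`, where `N = d + 1`. -/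
def BaseField : Type := FractionRing (stage p d).O

namespace BaseField

instance : Field (BaseField p d) := inferInstanceAs (Field (FractionRing (stage p d).O))
instance : Algebra (stage p d).O (BaseField p d) :=
  inferInstanceAs (Algebra (stage p d).O (FractionRing (stage p d).O))
instance : IsFractionRing (stage p d).O (BaseField p d) :=
  inferInstanceAs (IsFractionRing (stage p d).O (FractionRing (stage p d).O))

/-- The `p`-adic absolute value of `L₀`, with `|p| = 1 / p`. -/
def abv : AbsoluteValue (BaseField p d) ℝ :=
  (IsDiscreteValuationRing.maximalIdeal (stage p d).O).adicAbv (K := BaseField p d)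
    (b := p) (by exact_mod_cast (Fact.out : p.Prime).one_lt)

instance normedField : NormedField (BaseField p d) where
  norm := abv p d
  dist x y := abv p d (x - y)
  dist_self x := by simp
  dist_comm x y := (abv p d).map_sub x y
  dist_triangle x y z := (abv p d).sub_le x y z
  eq_of_dist_eq_zero {x y} h := by simpa [sub_eq_zero] using h
  dist_eq x y := by
    rw [← (abv p d).map_neg]; congr 1; ring
  norm_mul := (abv p d).map_mul

instance isUltrametricDist : IsUltrametricDist (BaseField p d) :=
  IsUltrametricDist.isUltrametricDist_of_forall_norm_add_le_max_norm
    (IsDedekindDomain.HeightOneSpectrum.isNonarchimedean_adicAbv _ _)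

lemma norm_algebraMap_le_one (a : (stage p d).O) : ‖algebraMap _ (BaseField p d) a‖ ≤ 1 :=
  IsDedekindDomain.HeightOneSpectrum.adicAbv_coe_le_one _ _ a

lemma exists_of_norm_le_one {x : BaseField p d} (hx : ‖x‖ ≤ 1) :
    ∃ a : (stage p d).O, algebraMap _ (BaseField p d) a = x := by
  apply IsDiscreteValuationRing.exists_lift_of_le_one
  have h : (((WithZeroMulInt.toNNReal (e := (p : NNReal))
    (by exact_mod_cast (Fact.out : p.Prime).ne_zero)
    ((IsDiscreteValuationRing.maximalIdeal (stage p d).O).valuation (BaseField p d) x) : NNReal))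
      : ℝ) ≤ 1 := hx
  exact (WithZeroMulInt.toNNReal_le_one_iff
    (e := (p : NNReal)) (by exact_mod_cast (Fact.out : p.Prime).one_lt)).1 (by exact_mod_cast h)

lemma p_ne_zero : (p : BaseField p d) ≠ 0 := by
  rw [← map_natCast (algebraMap (stage p d).O (BaseField p d))]
  exact fun h => (stage p d).irreducible_p.ne_zero
    ((IsFractionRing.injective (stage p d).O (BaseField p d)) (by rw [h, map_zero]))

lemma norm_p_lt_one : ‖(p : BaseField p d)‖ < 1 := by
  rw [← map_natCast (algebraMap (stage p d).O (BaseField p d))]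
  exact (IsDedekindDomain.HeightOneSpectrum.adicAbv_coe_lt_one_iff _ _ _).2
    ((IsLocalRing.mem_maximalIdeal _).2 (stage p d).not_isUnit)

lemma norm_p_pos : 0 < ‖(p : BaseField p d)‖ := norm_pos_iff.2 (p_ne_zero p d)

instance : NontriviallyNormedField (BaseField p d) where
  non_trivial := ⟨(p : BaseField p d)⁻¹, by
    rw [norm_inv]; exact (one_lt_inv₀ (norm_p_pos p d)).2 (norm_p_lt_one p d)⟩

lemma norm_le_pow_iff (n : ℕ) (a : (stage p d).O) :
    ‖algebraMap _ (BaseField p d) a‖ ≤ ‖(p : BaseField p d)‖ ^ n ↔ (p : (stage p d).O) ^ n ∣ a := by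
  constructor
  · intro h
    obtain ⟨b, hb⟩ := exists_of_norm_le_one p d
      (x := algebraMap _ (BaseField p d) a / (p : BaseField p d) ^ n) (by
        rw [norm_div, norm_pow]
        exact div_le_one_of_le₀ h (by positivity))
    refine ⟨b, IsFractionRing.injective (stage p d).O (BaseField p d) ?_⟩
    rw [map_mul, hb, map_pow, map_natCast]
    field_simp [p_ne_zero p d]
  · rintro ⟨b, rfl⟩
    rw [map_mul, map_pow, map_natCast, norm_mul, norm_pow]
    exact mul_le_of_le_one_right (by positivity) (norm_algebraMap_le_one p d b)

instance : CompleteSpace (BaseField p d) := by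
  have := (stage p d).complete
  refine Metric.complete_of_convergent_controlled_sequences
    (fun n => ‖(p : BaseField p d)‖ ^ n) (fun n => pow_pos (norm_p_pos p d) n) fun u hu => ?_
  have h0 : ∀ n, ∃ a : (stage p d).O, algebraMap _ (BaseField p d) a = u n - u 0 := fun n =>
    exists_of_norm_le_one p d (by
      have := hu 0 n 0 (Nat.zero_le _) le_rfl
      rw [dist_eq_norm, pow_zero] at this; exact this.le)
  choose a ha using h0
  obtain ⟨l, hl⟩ := IsPrecomplete.prec (I := Ideal.span {(p : (stage p d).O)})
    (M := (stage p d).O) inferInstance (f := a) (fun {m n} hmn => by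
      rw [SModEq.sub_mem, smul_eq_mul, Ideal.mul_top, Ideal.span_singleton_pow,
        Ideal.mem_span_singleton, ← norm_le_pow_iff, map_sub, ha, ha, sub_sub_sub_cancel_right,
        ← dist_eq_norm]
      exact (hu m m n le_rfl hmn).le)
  refine ⟨u 0 + algebraMap _ _ l, ?_⟩
  rw [tendsto_iff_dist_tendsto_zero]
  refine squeeze_zero (fun _ => dist_nonneg) (fun n => ?_)
    (tendsto_pow_atTop_nhds_zero_of_lt_one (norm_p_pos p d).le (norm_p_lt_one p d))
  have h := hl n
  rw [SModEq.sub_mem, smul_eq_mul, Ideal.mul_top, Ideal.span_singleton_pow,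
        Ideal.mem_span_singleton, ← norm_le_pow_iff, map_sub, ha] at h
  rwa [dist_eq_norm, ← sub_sub]

/-- The valuation ring `𝒪_{L₀} = {x | v(x) ≥ 0}` of the canonical valuation of rank `N = d + 1`:
the elements of the ring of integers of the first valuation whose residue lies in the valuation
ring of the `(N - 1)`-dimensional local field `𝔽_p((t_N))…((t_2))`. -/
def valRing : Subring (BaseField p d) :=
  ((stage p d).V.comap (stage p d).α).map (algebraMap (stage p d).O (BaseField p d))

lemma norm_le_one_of_mem {x : BaseField p d} (hx : x ∈ valRing p d) : ‖x‖ ≤ 1 := by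
  obtain ⟨a, -, rfl⟩ := hx
  exact norm_algebraMap_le_one p d a

end BaseField

/-- An algebraic closure of `L₀`, normed by the unique extension of the `p`-adic absolute value. -/
def AlgClosure : Type := AlgebraicClosure (BaseField p d)

namespace AlgClosure
instance : Field (AlgClosure p d) := inferInstanceAs (Field (AlgebraicClosure (BaseField p d)))
instance : Algebra (BaseField p d) (AlgClosure p d) :=
  inferInstanceAs (Algebra (BaseField p d) (AlgebraicClosure (BaseField p d)))
instance : IsAlgClosure (BaseField p d) (AlgClosure p d) :=
  inferInstanceAs (IsAlgClosure (BaseField p d) (AlgebraicClosure (BaseField p d)))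
instance : Algebra.IsAlgebraic (BaseField p d) (AlgClosure p d) := IsAlgClosure.isAlgebraic
instance normedField : NormedField (AlgClosure p d) :=
  spectralNorm.normedField (BaseField p d) (AlgClosure p d)
instance : NormedAlgebra (BaseField p d) (AlgClosure p d) :=
  spectralNorm.normedAlgebra (BaseField p d) (AlgClosure p d)
instance isUltrametricDist : IsUltrametricDist (AlgClosure p d) :=
  IsUltrametricDist.isUltrametricDist_of_forall_norm_add_le_max_norm
    (isNonarchimedean_spectralNorm (K := BaseField p d) (L := AlgClosure p d))
end AlgClosure

/-- The field `ℂ(N)_p`, where `N = d + 1`: the completion of the algebraic closure of `L₀` with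
respect to the first (`p`-adic) valuation. -/
abbrev CField : Type := UniformSpace.Completion (AlgClosure p d)

/-- The valuation ring `𝒪_{ℂ(N)_p}` of the (rank `N`) extension of the canonical valuation of `L₀`.
As `L₀` is Henselian for its canonical valuation, the valuation ring of the unique extension to the
algebraic closure is the integral closure of `𝒪_{L₀}`; the extension to the completion is by
continuity, so its valuation ring is the closure of the latter ring. -/
def CField.integers : Subring (CField p d) :=
  ((integralClosure (BaseField.valRing p d) (AlgClosure p d)).toSubring.map
    (algebraMap (AlgClosure p d) (CField p d))).topologicalClosure

namespace CField

lemma norm_p_lt_one : ‖(p : CField p d)‖ < 1 := by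
  have h1 : ((p : AlgClosure p d) : CField p d) = (p : CField p d) :=
    map_natCast (algebraMap (AlgClosure p d) (CField p d)) p
  rw [← h1, UniformSpace.Completion.norm_coe,
    ← map_natCast (algebraMap (BaseField p d) (AlgClosure p d)), norm_algebraMap']
  exact BaseField.norm_p_lt_one p d

lemma norm_le_one_of_mem_integers {x : CField p d} (hx : x ∈ integers p d) : ‖x‖ ≤ 1 := by
  rw [← mem_closedBall_zero_iff]
  refine closure_minimal ?_ Metric.isClosed_closedBall hx
  rintro _ ⟨y, hy, rfl⟩
  rw [mem_closedBall_zero_iff]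
  refine (UniformSpace.Completion.norm_coe y).trans_le ?_
  obtain ⟨f, hf, hfy⟩ : IsIntegral (BaseField.valRing p d) y := hy
  let ψ : BaseField.valRing p d →+* (NormedField.valuation (K := AlgClosure p d)).integer :=
    ((algebraMap (BaseField p d) (AlgClosure p d)).comp (BaseField.valRing p d).subtype).codRestrict
      _ (fun a => by
        change ‖algebraMap (BaseField p d) (AlgClosure p d) a‖₊ ≤ 1
        rw [nnnorm_algebraMap']
        exact BaseField.norm_le_one_of_mem p d a.2)
  have h1 : IsIntegral (NormedField.valuation (K := AlgClosure p d)).integer y :=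
    ⟨f.map ψ, hf.map ψ, by rw [Polynomial.eval₂_map]; exact hfy⟩
  exact (Valuation.integer.integers (NormedField.valuation (K := AlgClosure p d))).mem_of_integral h1

instance not_isUnit_p : Fact (¬ IsUnit (p : integers p d)) := ⟨fun h => by
  obtain ⟨u, hu⟩ := isUnit_iff_exists_inv.1 h
  have h1 : (p : CField p d) * u = 1 := by
    have := congrArg (integers p d).subtype hu
    simpa using this
  have h2 := norm_p_lt_one p d
  have h3 := norm_le_one_of_mem_integers p d u.2
  have h4 := congrArg norm h1
  rw [norm_mul, norm_one] at h4
  nlinarith [norm_nonneg (p : CField p d), norm_nonneg (u : CField p d)]⟩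

end CField

/-- `R(N)`: the inverse limit of copies of `𝒪_{ℂ(N)_p} / p` along the `p`-th power maps. -/
abbrev RRing : Type := PreTilt (CField.integers p d) p
/-- `R₀(N)`: the fraction field of `R(N)`. -/
abbrev RField : Type := FractionRing (RRing p d)

end Field

/-- The group of automorphisms `f` of `K` with `f(A) = A`. -/
def autPreserving {K : Type} [CommRing K] (A : Subring K) : Subgroup (K ≃+* K) where
  carrier := {f | ∀ x, f x ∈ A ↔ x ∈ A}
  one_mem' := fun _ => Iff.rfl
  mul_mem' {f g} hf hg := fun x => (hf (g x)).trans (hg x)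
  inv_mem' {f} hf := fun x => by
    have := hf (f.symm x)
    rw [RingEquiv.apply_symm_apply] at this
    exact this.symm

/-- Restriction of the automorphisms of `K` preserving `A` to `A`. -/
def autRestrict {K : Type} [CommRing K] (A : Subring K) : autPreserving A →* (A ≃+* A) where
  toFun f :=
    { toFun := fun x => ⟨f.1 x, (f.2 x).2 x.2⟩
      invFun := fun x => ⟨f.1.symm x, (f.2 _).1 (by rw [RingEquiv.apply_symm_apply]; exact x.2)⟩
      left_inv := fun x => Subtype.ext (f.1.symm_apply_apply x)
      right_inv := fun x => Subtype.ext (f.1.apply_symm_apply x)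
      map_mul' := fun x y => Subtype.ext (map_mul f.1 x.1 y.1)
      map_add' := fun x y => Subtype.ext (map_add f.1 x.1 y.1) }
  map_one' := rfl
  map_mul' _ _ := rfl

section Tilt
variable (A : Type) [CommRing A] [Fact p.Prime] [Fact (¬ IsUnit (p : A))]

/-- The endomorphism of `A / p` induced by an automorphism of `A`. -/
def modPMap (e : A ≃+* A) : ModP A p →+* ModP A p :=
  Ideal.quotientMap _ (e : A →+* A) (by
    rw [Ideal.span_singleton_le_iff_mem, Ideal.mem_comap]
    simp)

/-- The endomorphism `(rₙ)ₙ ↦ (e(rₙ))ₙ` of `lim A / p` induced by an automorphism `e` of `A`. -/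
def preTiltMap (e : A ≃+* A) : PreTilt A p →+* PreTilt A p := Perfection.map p (modPMap A e)

lemma coeff_preTiltMap (e : A ≃+* A) (r : PreTilt A p) (n : ℕ) :
    PreTilt.coeff n (preTiltMap A e r) = modPMap A e (PreTilt.coeff n r) := rfl

lemma preTiltMap_mul (e e' : A ≃+* A) (r : PreTilt A p) :
    preTiltMap A (e * e') r = preTiltMap A e (preTiltMap A e' r) := by
  refine Perfection.ext fun n => ?_
  change modPMap A (e * e') (PreTilt.coeff n r) = modPMap A e (modPMap A e' (PreTilt.coeff n r))
  obtain ⟨a, ha⟩ := Ideal.Quotient.mk_surjective (PreTilt.coeff n r)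
  rw [← ha]; rfl

lemma preTiltMap_one (r : PreTilt A p) : preTiltMap A 1 r = r := by
  refine Perfection.ext fun n => ?_
  change modPMap A 1 (PreTilt.coeff n r) = PreTilt.coeff n r
  obtain ⟨a, ha⟩ := Ideal.Quotient.mk_surjective (PreTilt.coeff n r)
  rw [← ha]; rfl

/-- The action of the automorphisms of `A` on `lim A / p`. -/
def preTiltAut : (A ≃+* A) →* (PreTilt A p ≃+* PreTilt A p) where
  toFun e := RingEquiv.ofRingHom (preTiltMap A e) (preTiltMap A e⁻¹)
    (RingHom.ext fun r => by
      rw [RingHom.comp_apply, ← preTiltMap_mul, mul_inv_cancel, preTiltMap_one]; rfl)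
    (RingHom.ext fun r => by
      rw [RingHom.comp_apply, ← preTiltMap_mul, inv_mul_cancel, preTiltMap_one]; rfl)
  map_one' := RingEquiv.ext (preTiltMap_one A)
  map_mul' e e' := RingEquiv.ext (preTiltMap_mul A e e')

end Tilt

section Main
variable (p) [Fact p.Prime] (d : ℕ)

/-- The automorphisms of the field `ℂ(N)_p` with its valuation (i.e. preserving `𝒪_{ℂ(N)_p}`). -/
abbrev AutC : Subgroup (CField p d ≃+* CField p d) := autPreserving (CField.integers p d)

/-- The automorphisms of the field `R₀(N)` with its valuation (i.e. preserving `R(N)`). -/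
abbrev AutR : Subgroup (RField p d ≃+* RField p d) :=
  autPreserving (algebraMap (RRing p d) (RField p d)).range

/-- The correspondence `f ↦ f_R`: reduce `f` modulo `p` on `𝒪_{ℂ(N)_p}`, pass to the inverse limit
`R(N)`, and then to its fraction field `R₀(N)`. -/
def inducedAut : AutC p d →* (RField p d ≃+* RField p d) :=
  ((IsFractionRing.ringEquivOfRingEquivHom (A := RRing p d) (K := RField p d)).comp
    (preTiltAut (CField.integers p d))).comp (autRestrict (CField.integers p d))

lemma inducedAut_algebraMap (f : AutC p d) (r : RRing p d) :
    inducedAut p d f (algebraMap (RRing p d) (RField p d) r) =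
      algebraMap (RRing p d) (RField p d)
        (preTiltMap (CField.integers p d) (autRestrict (CField.integers p d) f) r) :=
  IsFractionRing.ringEquivOfRingEquiv_algebraMap _ _

/-- The data of a Fontaine element `ε = (ε⁽ⁿ⁾ mod p)ₙ`: a sequence with `ε⁽⁰⁾ = 1`, `ε⁽¹⁾ ≠ 1` and
`(ε⁽ⁿ⁺¹⁾)ᵖ = ε⁽ⁿ⁾`. -/
structure FontaineElement where
  root : ℕ → CField.integers p d
  root_zero : root 0 = 1
  root_one_ne : root 1 ≠ 1
  root_succ_pow : ∀ n, root (n + 1) ^ p = root n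

namespace FontaineElement
variable {p d}

lemma root_pow (ε : FontaineElement p d) (n : ℕ) : ε.root n ^ p ^ n = 1 := by
  induction n with
  | zero => simp [ε.root_zero]
  | succ n ih => rw [pow_succ', pow_mul, ε.root_succ_pow, ih]

/-- The element `ε^a` of `R(N)` for `a ∈ ℤ_p`. Its `n`-th component is `(ε⁽ⁿ⁾)^a mod p`, where the
power of the `pⁿ`-th root of unity `ε⁽ⁿ⁾` is computed through the residue of `a` modulo `pⁿ`. -/
def zpPow (ε : FontaineElement p d) (a : ℤ_[p]) : RRing p d :=
  ⟨fun n => Ideal.Quotient.mk _ (ε.root n ^ a.appr n), fun n => by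
    rw [← map_pow]; congr 1
    obtain ⟨c, hc⟩ := PadicInt.dvd_appr_sub_appr a n (n + 1) n.le_succ
    have h : a.appr (n + 1) = a.appr n + p ^ n * c := by
      rw [← hc, Nat.add_sub_cancel' (PadicInt.appr_mono a n.le_succ)]
    rw [← pow_mul, mul_comm, pow_mul, ε.root_succ_pow, h, pow_add, pow_mul, ε.root_pow, one_pow,
      mul_one]⟩

/-- `⟨ε⟩ = ε^{ℤ_p}`, as a subset of `R₀(N)`. -/
def group (ε : FontaineElement p d) : Set (RField p d) :=
  Set.range fun a : ℤ_[p] => algebraMap (RRing p d) (RField p d) (ε.zpPow a)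

/-- `Aut' R₀(N)`: the automorphisms `g` of `R₀(N)` (preserving `R(N)`) with `g(⟨ε⟩) = ⟨ε⟩`. -/
def autStabilizing (ε : FontaineElement p d) : Subgroup (RField p d ≃+* RField p d) :=
  AutR p d ⊓
  { carrier := {g | g '' ε.group = ε.group}
    one_mem' := Set.image_id _
    mul_mem' := fun {f g} hf hg => by
      change (fun x => f (g x)) '' ε.group = ε.group
      rw [← Set.image_image f g, hg, hf]
    inv_mem' := fun {f} hf => by
      change f.symm '' ε.group = ε.group
      conv_lhs => rw [← hf]
      rw [Set.image_image]; simp }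

end FontaineElement

end Main
end HigherLocal

end

/-!
# Automorphisms of `ℂ(N)_p` and of the field `R₀(N)`

Write `𝒪` for the ring of integers of `ℂ(N)_p` and `R = lim 𝒪 / p` for its tilt. The ring `𝒪` is
`p`-adically complete with surjective Frobenius on `𝒪 / p`, so Fontaine's map `θ : W(R) → 𝒪` is
surjective, and an automorphism `f` of `𝒪` satisfies `f ∘ θ = θ ∘ W(f_R)`. Hence `f_R` determines
`f` (`eq_one_of_preTiltMap_eq`). Conversely an automorphism `g` of `R` comes from `𝒪` as soon as
`W(g)` preserves the kernel of `θ` (`exists_preTiltMap_eq`).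

The stabilizer condition enters through the equality `⟨ε⟩ = {x ∈ R | untilt x = 1}`
(`FontaineElement.exists_zpPow_eq_iff`): an element with untilt `1` is a compatible sequence of
`pⁿ`-th roots of unity. Since `untilt (f_R x) = f (untilt x)`, every `f_R` stabilizes `⟨ε⟩`. If `g`
stabilizes `⟨ε⟩` and `e = ε^{1/p}`, then `untilt (g e)` is a `p`-th root of unity different from
`1`, just as `untilt e`. So `W(g)` maps `ω = 1 + [e] + ⋯ + [e]ᵖ⁻¹` into the kernel of `θ`, and it
remains to see that `ω` generates this kernel modulo `p` (`exists_eq_of_fontaineTheta_eq_zero`);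
as `𝒪` has no `p`-torsion and is `p`-adically separated, that is enough
(`fontaineTheta_map_eq_zero`).

The reduction of `ω` is `(e - 1)ᵖ⁻¹`, and its untilt is `p` times a unit because it is congruent
modulo `p²` to `(ζ - 1)^{p(p-1)}` for a primitive `p²`-th root of unity `ζ`
(`associated_untilt_sub_one_pow`). An element of `R` whose untilt is divisible by `p` is therefore
divisible by `(e - 1)ᵖ⁻¹` (`dvd_of_untilt_dvd_untilt`); here one extracts `p`-th roots, and uses
that `x ∈ ℂ(N)_p` lies in `𝒪` if `xᵖ` does (`CField.mem_integers_of_pow_mem`). The latter holds as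
`𝒪` contains the open unit ball of the first valuation and the algebraic elements of `𝒪` are exactly
those integral over `𝒪_{L₀}`.
-/

noncomputable section
namespace HigherLocal

/-! ### The ring of integers of `ℂ(N)_p` -/

section Integers
variable (p : ℕ) [Fact p.Prime] (d : ℕ)

instance AlgClosure.isAlgClosed : IsAlgClosed (AlgClosure p d) :=
  IsAlgClosure.isAlgClosed (BaseField p d)

lemma BaseField.mem_valRing_of_norm_lt_one {x : BaseField p d} (hx : ‖x‖ < 1) :
    x ∈ BaseField.valRing p d := by
  obtain ⟨a, rfl⟩ := BaseField.exists_of_norm_le_one p d hx.le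
  refine ⟨a, ?_, rfl⟩
  have h1 : a ∈ (IsDiscreteValuationRing.maximalIdeal (stage p d).O).asIdeal :=
    (IsDedekindDomain.HeightOneSpectrum.adicAbv_coe_lt_one_iff _ _ _).1 hx
  have h2 : ¬ IsUnit a := (IsLocalRing.mem_maximalIdeal _).1 h1
  have h3 : (stage p d).α a = 0 := by
    by_contra h
    exact h2 ((stage p d).isUnit_of h)
  change (stage p d).α a ∈ (stage p d).V
  rw [h3]
  exact Subring.zero_mem _

lemma AlgClosure.isIntegral_of_norm_lt_one {y : AlgClosure p d} (hy : ‖y‖ < 1) :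
    IsIntegral (BaseField.valRing p d) y := by
  have hint : IsIntegral (BaseField p d) y := Algebra.IsIntegral.isIntegral y
  set f := minpoly (BaseField p d) y with hf
  have hmonic : f.Monic := minpoly.monic hint
  -- The spectral norm bounds each lower coefficient of the minimal polynomial.
  have hcoeff : ∀ n, f.coeff n ∈ BaseField.valRing p d := by
    intro n
    rcases lt_trichotomy n f.natDegree with hn | hn | hn
    · refine BaseField.mem_valRing_of_norm_lt_one p d ?_
      have h1 : spectralValueTerms f n ≤ ‖y‖ :=
        le_ciSup (spectralValueTerms_bddAbove f) n
      rw [spectralValueTerms_of_lt_natDegree f hn] at h1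
      by_contra! h2
      have h3 : (1 : ℝ) ≤ ‖f.coeff n‖ ^ (1 / (f.natDegree - n : ℝ)) := by
        refine Real.one_le_rpow h2 ?_
        have : (n : ℝ) < f.natDegree := by exact_mod_cast hn
        have : (0 : ℝ) < f.natDegree - n := by linarith
        positivity
      linarith
    · rw [hn, hmonic.coeff_natDegree]
      exact Subring.one_mem _
    · rw [Polynomial.coeff_eq_zero_of_natDegree_lt hn]
      exact Subring.zero_mem _
  have hsub : (f.coeffs : Set (BaseField p d)) ⊆ BaseField.valRing p d := by
    intro c hc
    obtain ⟨n, -, rfl⟩ := Polynomial.mem_coeffs_iff.1 (Finset.mem_coe.1 hc)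
    exact hcoeff n
  refine ⟨f.toSubring _ hsub, (Polynomial.monic_toSubring _ _ _).2 hmonic, ?_⟩
  have h1 : (f.toSubring _ hsub).map (BaseField.valRing p d).subtype = f :=
    Polynomial.map_toSubring _ _ _
  have h2 : Polynomial.eval₂ (algebraMap (BaseField p d) (AlgClosure p d)) y f = 0 :=
    minpoly.aeval _ y
  rw [← h1, Polynomial.eval₂_map] at h2
  exact h2

namespace CField

/-- The open unit ball of the first valuation lies in the rank `N` valuation ring. -/
lemma mem_integers_of_norm_lt_one {x : CField p d} (hx : ‖x‖ < 1) : x ∈ integers p d := by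
  change x ∈ closure _
  have h1 : x ∈ Metric.ball (0 : CField p d) 1 := by simpa using hx
  refine closure_mono ?_ (UniformSpace.Completion.denseRange_coe.open_subset_closure_inter
    Metric.isOpen_ball h1)
  rintro _ ⟨hy, y, rfl⟩
  refine ⟨y, AlgClosure.isIntegral_of_norm_lt_one p d ?_, rfl⟩
  simpa [UniformSpace.Completion.norm_coe] using hy

lemma coe_mem_integers_iff {y : AlgClosure p d} :
    (y : CField p d) ∈ integers p d ↔ IsIntegral (BaseField.valRing p d) y := by
  constructor
  · intro h
    obtain ⟨_, ⟨b, hb, rfl⟩, hyb⟩ := Metric.mem_closure_iff.1 (show _ ∈ closure _ from h) 1 one_pos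
    have h1 : ‖y - b‖ < 1 := by
      rw [← UniformSpace.Completion.norm_coe, UniformSpace.Completion.coe_sub, ← dist_eq_norm]
      exact hyb
    have h2 := (AlgClosure.isIntegral_of_norm_lt_one p d h1).add hb
    rwa [sub_add_cancel] at h2
  · intro h
    exact subset_closure ⟨y, h, rfl⟩

lemma exists_coe_norm_sub_lt (x : CField p d) {r : ℝ} (hr : 0 < r) :
    ∃ y : AlgClosure p d, ‖x - y‖ < r := by
  obtain ⟨y, hy⟩ := UniformSpace.Completion.denseRange_coe.exists_dist_lt x hr
  exact ⟨y, by rwa [dist_eq_norm] at hy⟩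

/-- An element of `ℂ(N)_p` with a power in the ring of integers lies in it: it may be approximated
by an algebraic element with the same property, which is then integral over `𝒪_{L₀}`. -/
lemma mem_integers_of_pow_mem {x : CField p d} {n : ℕ} (hn : 0 < n)
    (hx : x ^ n ∈ integers p d) : x ∈ integers p d := by
  have hopen : IsOpen {y : CField p d | ‖x - y‖ < 1 ∧ ‖y ^ n - x ^ n‖ < 1} :=
    (isOpen_lt (f := fun y => ‖x - y‖) (by fun_prop) continuous_const).inter
      (isOpen_lt (f := fun y => ‖y ^ n - x ^ n‖) (by fun_prop) continuous_const)
  obtain ⟨y, hy1, hy2⟩ := UniformSpace.Completion.denseRange_coe.exists_mem_open hopen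
    ⟨x, by simp⟩
  have h1 : ((y ^ n : AlgClosure p d) : CField p d) ∈ integers p d := by
    have h2 := (integers p d).add_mem (mem_integers_of_norm_lt_one p d hy2) hx
    rw [sub_add_cancel] at h2
    have h3 : ((y ^ n : AlgClosure p d) : CField p d) = (y : CField p d) ^ n :=
      map_pow (algebraMap (AlgClosure p d) (CField p d)) y n
    rwa [h3]
  have h4 : IsIntegral (BaseField.valRing p d) y :=
    ((coe_mem_integers_iff p d).1 h1).of_pow hn
  have h5 := (integers p d).add_mem (mem_integers_of_norm_lt_one p d hy1)
    ((coe_mem_integers_iff p d).2 h4)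
  rwa [sub_add_cancel] at h5

lemma p_ne_zero : (p : CField p d) ≠ 0 := by
  have h1 : algebraMap (AlgClosure p d) (CField p d)
      (algebraMap (BaseField p d) (AlgClosure p d) p) = (p : CField p d) := by simp
  rw [← h1]
  simpa only [ne_eq, map_eq_zero] using BaseField.p_ne_zero p d

lemma norm_p_pos : 0 < ‖(p : CField p d)‖ := norm_pos_iff.2 (p_ne_zero p d)

instance neZero_p : NeZero (p : integers p d) := ⟨fun h => p_ne_zero p d (by
  simpa using congrArg (integers p d).subtype h)⟩

lemma norm_le_pow_of_pow_dvd {n : ℕ} {x : integers p d} (hx : (p : integers p d) ^ n ∣ x) :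
    ‖(x : CField p d)‖ ≤ ‖(p : CField p d)‖ ^ n := by
  obtain ⟨y, rfl⟩ := hx
  push_cast
  rw [norm_mul, norm_pow]
  exact mul_le_of_le_one_right (by positivity) (norm_le_one_of_mem_integers p d y.2)

lemma pow_dvd_of_mem {n : ℕ} {x : integers p d}
    (hx : (x : CField p d) / (p : CField p d) ^ n ∈ integers p d) : (p : integers p d) ^ n ∣ x := by
  refine ⟨⟨_, hx⟩, Subtype.ext ?_⟩
  push_cast
  field_simp [p_ne_zero p d]

lemma pow_dvd_of_norm_lt {n : ℕ} {x : integers p d}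
    (hx : ‖(x : CField p d)‖ < ‖(p : CField p d)‖ ^ n) : (p : integers p d) ^ n ∣ x := by
  refine pow_dvd_of_mem p d (mem_integers_of_norm_lt_one p d ?_)
  rw [norm_div, norm_pow]
  exact (div_lt_one (pow_pos (norm_p_pos p d) n)).2 hx

lemma isClosed_integers : IsClosed (integers p d : Set (CField p d)) :=
  Subring.isClosed_topologicalClosure _

instance isAdicComplete_integers :
    IsAdicComplete (Ideal.span {(p : integers p d)}) (integers p d) where
  haus' x hx := by
    have h1 : ∀ n : ℕ, ‖(x : CField p d)‖ ≤ ‖(p : CField p d)‖ ^ n := fun n => by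
      refine norm_le_pow_of_pow_dvd p d ?_
      have := hx n
      rwa [SModEq.zero, smul_eq_mul, Ideal.mul_top, Ideal.span_singleton_pow,
        Ideal.mem_span_singleton] at this
    have h2 : ‖(x : CField p d)‖ ≤ 0 := ge_of_tendsto'
      (tendsto_pow_atTop_nhds_zero_of_lt_one (norm_nonneg _) (norm_p_lt_one p d)) h1
    exact Subtype.ext (norm_le_zero_iff.1 h2)
  prec' a ha := by
    have hdvd : ∀ {m n}, m ≤ n → (p : integers p d) ^ m ∣ a n - a m := fun {m n} hmn => by
      have := (ha hmn).symm
      rwa [SModEq.sub_mem, smul_eq_mul, Ideal.mul_top, Ideal.span_singleton_pow,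
        Ideal.mem_span_singleton] at this
    have hcauchy : CauchySeq fun n => (a n : CField p d) := by
      refine cauchySeq_of_le_tendsto_0 (fun n => ‖(p : CField p d)‖ ^ n + ‖(p : CField p d)‖ ^ n)
        (fun n m N hn hm => ?_) ?_
      · rw [dist_eq_norm, ← sub_sub_sub_cancel_right _ _ (a N : CField p d)]
        exact (norm_sub_le _ _).trans (add_le_add (norm_le_pow_of_pow_dvd p d (hdvd hn))
          (norm_le_pow_of_pow_dvd p d (hdvd hm)))
      · simpa using (tendsto_pow_atTop_nhds_zero_of_lt_one (norm_nonneg _)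
          (norm_p_lt_one p d)).add (tendsto_pow_atTop_nhds_zero_of_lt_one
            (norm_nonneg (p : CField p d)) (norm_p_lt_one p d))
    obtain ⟨l, hl⟩ := cauchySeq_tendsto_of_complete hcauchy
    have hmem : l ∈ integers p d :=
      (isClosed_integers p d).mem_of_tendsto hl (Filter.Eventually.of_forall fun n => (a n).2)
    refine ⟨⟨l, hmem⟩, fun n => ?_⟩
    rw [SModEq.comm, SModEq.sub_mem, smul_eq_mul, Ideal.mul_top, Ideal.span_singleton_pow,
        Ideal.mem_span_singleton]
    refine pow_dvd_of_mem p d ?_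
    -- `(l - aₙ) / pⁿ` is the limit of `(aₘ - aₙ) / pⁿ ∈ 𝒪`, and `𝒪` is closed.
    refine (isClosed_integers p d).mem_of_tendsto
      ((hl.sub_const (a n : CField p d)).div_const ((p : CField p d) ^ n)) ?_
    filter_upwards [Filter.eventually_ge_atTop n] with m hm
    obtain ⟨c, hc⟩ := hdvd hm
    have h1 : (a m : CField p d) - a n = (p : CField p d) ^ n * c := by
      have := congrArg (integers p d).subtype hc
      simpa using this
    rw [h1, mul_div_cancel_left₀ _ (pow_ne_zero _ (p_ne_zero p d))]
    exact c.2

lemma frobenius_modP_surjective :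
    Function.Surjective (frobenius (ModP (integers p d) p) p) := by
  intro r
  obtain ⟨x, rfl⟩ := Ideal.Quotient.mk_surjective r
  obtain ⟨y, hy⟩ := exists_coe_norm_sub_lt p d (x : CField p d) (norm_p_pos p d)
  have hy1 : (y : CField p d) ∈ integers p d := by
    have h1 := (integers p d).sub_mem x.2
      (mem_integers_of_norm_lt_one p d (hy.trans (norm_p_lt_one p d)))
    rwa [sub_sub_cancel] at h1
  obtain ⟨z, hz⟩ := IsAlgClosed.exists_pow_nat_eq y (Fact.out : p.Prime).pos
  have hz1 : (z : CField p d) ^ p = y := by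
    rw [← hz]
    exact (map_pow (algebraMap (AlgClosure p d) (CField p d)) z p).symm
  have hz2 : (z : CField p d) ∈ integers p d :=
    mem_integers_of_pow_mem p d (Fact.out : p.Prime).pos (by rwa [hz1])
  refine ⟨Ideal.Quotient.mk _ ⟨z, hz2⟩, ?_⟩
  rw [frobenius_def, ← map_pow, eq_comm, Ideal.Quotient.eq, Ideal.mem_span_singleton,
    ← pow_one (p : integers p d)]
  refine pow_dvd_of_norm_lt p d ?_
  push_cast
  rwa [hz1, pow_one]

/-- Multiplying by a large power of `p` moves any element of `ℂ(N)_p` into the open unit ball. -/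
instance isFractionRing_integers : IsFractionRing (integers p d) (CField p d) :=
  IsFractionRing.of_field _ _ fun x => by
    have h1 : Filter.Tendsto (fun n : ℕ => ‖(p : CField p d) ^ n * x‖) Filter.atTop (nhds 0) := by
      simpa [norm_mul, norm_pow] using (tendsto_pow_atTop_nhds_zero_of_lt_one
        (norm_nonneg (p : CField p d)) (norm_p_lt_one p d)).mul_const ‖x‖
    obtain ⟨n, hn⟩ := (h1.eventually_lt_const one_pos).exists
    refine ⟨⟨_, mem_integers_of_norm_lt_one p d hn⟩, (p : integers p d) ^ n, ?_⟩
    rw [map_pow, map_natCast]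
    change x = (p : CField p d) ^ n * x / (p : CField p d) ^ n
    rw [mul_div_cancel_left₀ _ (pow_ne_zero _ (p_ne_zero p d))]

lemma dvd_of_pow_dvd_pow {a b : integers p d} {n : ℕ} (hn : 0 < n) (h : b ^ n ∣ a ^ n) :
    b ∣ a := by
  by_cases hb : b = 0
  · subst hb
    rw [zero_pow hn.ne', zero_dvd_iff] at h
    rw [eq_zero_of_pow_eq_zero h]
  · obtain ⟨c, hc⟩ := h
    have hb' : (b : CField p d) ≠ 0 := fun h0 => hb (Subtype.ext h0)
    have h1 : ((a : CField p d) / b) ^ n = c := by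
      rw [div_pow, div_eq_iff (pow_ne_zero _ hb'), mul_comm]
      simpa using congrArg (integers p d).subtype hc
    refine ⟨⟨a / b, mem_integers_of_pow_mem p d hn (by rw [h1]; exact c.2)⟩, Subtype.ext ?_⟩
    push_cast
    rw [mul_div_cancel₀ _ hb']

end CField
end Integers

/-! ### Sharp sequences and divisibility in the tilt -/

section General
open WittVector Polynomial

variable {A : Type} [CommRing A] {p : ℕ} [Fact p.Prime]

lemma associated_sub_one_pow_totient [IsDomain A] {k : ℕ} {ζ : A}
    (hζ : IsPrimitiveRoot ζ (p ^ (k + 1))) :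
    Associated ((ζ - 1) ^ (p ^ (k + 1)).totient) (p : A) := by
  have h1 := eval_one_cyclotomic_prime_pow (R := A) (p := p) k
  rw [cyclotomic_eq_prod_X_sub_primitiveRoots hζ, eval_prod] at h1
  rw [← h1, ← hζ.card_primitiveRoots, ← Finset.prod_const]
  have hpos : 0 < p ^ (k + 1) := pow_pos (Fact.out : p.Prime).pos _
  have : NeZero (p ^ (k + 1)) := ⟨hpos.ne'⟩
  refine Associated.prod _ _ _ fun μ hμ => ?_
  obtain ⟨i, -, hi, rfl⟩ := hζ.isPrimitiveRoot_iff.1 ((mem_primitiveRoots hpos).1 hμ)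
  rw [eval_sub, eval_X, eval_C, ← neg_sub (ζ ^ i)]
  exact (hζ.associated_sub_one_pow_sub_one_of_coprime hi).neg_right

variable [Fact (¬ IsUnit (p : A))] [IsAdicComplete (Ideal.span {(p : A)}) A]

/-- The isomorphism of monoids between the sequences `(aₙ)` in `A` with `aₙ₊₁ᵖ = aₙ` and the tilt
`lim A / p`; it reduces every term modulo `p`. -/
def sharpEquiv : Perfection A p ≃* PreTilt A p :=
  Perfection.quotientMulEquiv p (Ideal.span {(p : A)})

lemma coeff_sharpEquiv (a : Perfection A p) (n : ℕ) :
    PreTilt.coeff n (sharpEquiv a) =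
      Ideal.Quotient.mk (Ideal.span {(p : A)}) (Perfection.coeffMonoidHom A p n a) := rfl

lemma untilt_sharpEquiv (a : Perfection A p) :
    PreTilt.untilt (sharpEquiv a) = Perfection.coeffMonoidHom A p 0 a :=
  Perfection.teichmuller₀_mapMonoidHom_idealQuotientMk

lemma pow_dvd_untilt_sub_pow {r : PreTilt A p} {n : ℕ} {a : A}
    (h : Ideal.Quotient.mk (Ideal.span {(p : A)}) a = PreTilt.coeff n r) :
    (p : A) ^ (n + 1) ∣ PreTilt.untilt r - a ^ p ^ n := by
  have h1 := Perfection.teichmuller_sModEq h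
  rwa [SModEq.sub_mem, Ideal.span_singleton_pow, Ideal.mem_span_singleton] at h1

/-- Divisibility of untilts implies divisibility in the tilt as soon as divisibility in `A` can be
tested on `p`-th powers: the termwise quotient of the sharp sequences is again such a sequence. -/
lemma dvd_of_untilt_dvd_untilt [IsDomain A] (hA : ∀ a b : A, b ^ p ∣ a ^ p → b ∣ a)
    {r s : PreTilt A p} (hs : s.untilt ≠ 0) (h : s.untilt ∣ r.untilt) : s ∣ r := by
  obtain ⟨a, rfl⟩ := sharpEquiv.surjective r
  obtain ⟨b, rfl⟩ := sharpEquiv.surjective s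
  rw [untilt_sharpEquiv] at hs h
  rw [untilt_sharpEquiv] at h
  have ha := Perfection.coeffMonoidHom_pow_p' a
  have hb := Perfection.coeffMonoidHom_pow_p' b
  have hb0 : ∀ n, Perfection.coeffMonoidHom A p n b ≠ 0 := fun n hn => by
    have h1 := Perfection.coeffMonoidHom_pow_p_pow_self b n
    rw [hn, zero_pow (pow_pos (Fact.out : p.Prime).pos n).ne'] at h1
    exact hs h1.symm
  have hdvd : ∀ n, Perfection.coeffMonoidHom A p n b ∣ Perfection.coeffMonoidHom A p n a := by
    intro n
    induction n with
    | zero => exact h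
    | succ n ih => exact hA _ _ (by rwa [ha, hb])
  choose c hc using hdvd
  have hcp : ∀ n, c (n + 1) ^ p = c n := fun n => by
    apply mul_left_cancel₀ (hb0 n)
    rw [← hc n, ← hb n, ← mul_pow, ← hc (n + 1), ha n]
  let q : Perfection A p := ⟨c, hcp⟩
  have hq : a = b * q := Perfection.extMonoid hc
  exact ⟨sharpEquiv q, by rw [hq, map_mul]⟩

/-- The distinguished element: if `e` is the reduction of a sequence `ζ_p, ζ_{p²}, …` of primitive
roots of unity, then `(e - 1)ᵖ⁻¹` has an untilt associated to `p`. -/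
lemma associated_untilt_sub_one_pow [IsDomain A] {e : Perfection A p}
    (he : IsPrimitiveRoot (Perfection.coeffMonoidHom A p 1 e) (p ^ 2)) :
    Associated (PreTilt.untilt ((sharpEquiv e - 1) ^ (p - 1))) (p : A) := by
  set ζ := Perfection.coeffMonoidHom A p 1 e with hζ
  have h1 : (p : A) ^ 2 ∣ PreTilt.untilt (sharpEquiv e - 1) - (ζ - 1) ^ p ^ 1 :=
    pow_dvd_untilt_sub_pow (by rw [map_sub, map_sub, map_one, map_one, coeff_sharpEquiv])
  have h2 : (p : A) ^ 2 ∣ PreTilt.untilt ((sharpEquiv e - 1) ^ (p - 1)) -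
      (ζ - 1) ^ (p ^ (1 + 1)).totient := by
    have h3 : (p ^ (1 + 1)).totient = p ^ 1 * (p - 1) :=
      Nat.totient_prime_pow_succ (Fact.out : p.Prime) 1
    rw [h3, map_pow, pow_mul]
    exact h1.trans (sub_dvd_pow_sub_pow _ _ _)
  obtain ⟨u, hu⟩ := (associated_sub_one_pow_totient (k := 1) he).symm
  rw [← hu] at h2
  obtain ⟨c, hc⟩ := h2
  have h4 : PreTilt.untilt ((sharpEquiv e - 1) ^ (p - 1)) =
      (p : A) * ((u : A) + (p : A) * c) := by
    linear_combination hc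
  -- `p` lies in the Jacobson radical, so `u + p c` is a unit.
  have h5 : IsUnit ((u : A) + p * c) := by
    have h6 : (p : A) ∈ Ideal.jacobson (⊥ : Ideal A) :=
      IsAdicComplete.le_jacobson_bot (Ideal.span {(p : A)}) (Ideal.mem_span_singleton_self _)
    have h7 := Ideal.mem_jacobson_bot.1 h6 (c * (u⁻¹ : Aˣ))
    have h8 : (u : A) + p * c = u * (p * (c * (u⁻¹ : Aˣ)) + 1) := by
      have := u.mul_inv
      linear_combination (-(p : A) * c) * this
    rw [h8]
    exact u.isUnit.mul h7
  obtain ⟨v, hv⟩ := h5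
  exact Associated.symm ⟨v, by rw [h4, hv]⟩

lemma geom_sum_eq_sub_one_pow {R : Type} [CommRing R] [CharP R p] (x : R) :
    ∑ i ∈ Finset.range p, x ^ i = (x - 1) ^ (p - 1) := by
  have h1 := cyclotomic_mul_prime_eq_pow_of_not_dvd R (p := p) (n := 1)
    (Fact.out : p.Prime).not_dvd_one
  rw [one_mul, cyclotomic_one, cyclotomic_prime] at h1
  simpa [eval_finsetSum] using congrArg (eval x) h1

/-! ### The kernel of `θ` -/

/-- The kernel of `θ` is generated modulo `p` by `1 + [e] + ⋯ + [e]ᵖ⁻¹`. -/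
lemma exists_eq_of_fontaineTheta_eq_zero [IsDomain A] [NeZero (p : A)]
    (hA : ∀ a b : A, b ^ p ∣ a ^ p → b ∣ a) {e : Perfection A p}
    (he : IsPrimitiveRoot (Perfection.coeffMonoidHom A p 1 e) (p ^ 2))
    {x : WittVector p (PreTilt A p)} (hx : fontaineTheta A p x = 0) :
    ∃ y x', x = (∑ i ∈ Finset.range p, teichmuller p (sharpEquiv e) ^ i) * y + p * x' := by
  have hw := associated_untilt_sub_one_pow he
  have h1 : (p : A) ∣ PreTilt.untilt (x.coeff 0) := by
    rw [← Ideal.mem_span_singleton, ← Ideal.Quotient.eq_zero_iff_mem,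
      PreTilt.mk_untilt_eq_coeff_zero, ← mk_fontaineTheta, hx, map_zero]
  obtain ⟨s, hs⟩ := dvd_of_untilt_dvd_untilt hA (hw.ne_zero_iff.2 (NeZero.ne _))
    (hw.dvd.trans h1)
  have h2 : (x - (∑ i ∈ Finset.range p, teichmuller p (sharpEquiv e) ^ i) *
      teichmuller p s).coeff 0 = 0 := by
    change constantCoeff (x - _) = 0
    have h3 : ∀ r : PreTilt A p, constantCoeff (teichmuller p r) = r :=
      fun r => teichmuller_coeff_zero p r
    rw [map_sub, map_mul, map_sum, h3]
    simp only [map_pow, h3]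
    rw [geom_sum_eq_sub_one_pow, ← hs]
    exact sub_self _
  obtain ⟨x', hx'⟩ := Ideal.mem_span_singleton.1 ((mem_span_p_iff_coeff_zero_eq_zero _).2 h2)
  exact ⟨teichmuller p s, x', by linear_combination hx'⟩

lemma eq_of_forall_pow_dvd_sub {a b : A} (h : ∀ n, (p : A) ^ n ∣ a - b) : a = b := by
  rw [IsHausdorff.eq_iff_smodEq (I := Ideal.span {(p : A)})]
  intro n
  rw [SModEq.sub_mem, smul_eq_mul, Ideal.mul_top, Ideal.span_singleton_pow,
    Ideal.mem_span_singleton]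
  exact h n

lemma ringHom_eq_of_apply_teichmuller_eq {φ ψ : WittVector p (PreTilt A p) →+* A}
    (h : ∀ r, φ (teichmuller p r) = ψ (teichmuller p r)) : φ = ψ := by
  refine RingHom.ext fun x => eq_of_forall_pow_dvd_sub (p := p) fun n => ?_
  induction n generalizing x with
  | zero => simp
  | succ n ih =>
    have h1 : (x - teichmuller p (x.coeff 0)).coeff 0 = 0 := by
      change constantCoeff (x - _) = 0
      rw [map_sub]
      exact sub_eq_zero.2 (teichmuller_coeff_zero p _).symm
    obtain ⟨y, hy⟩ := Ideal.mem_span_singleton.1 ((mem_span_p_iff_coeff_zero_eq_zero _).2 h1)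
    rw [sub_eq_iff_eq_add] at hy
    obtain ⟨c, hc⟩ := ih y
    refine ⟨c, ?_⟩
    rw [hy, map_add, map_add, map_mul, map_mul, h, map_natCast, map_natCast]
    linear_combination (p : A) * hc

/-- If `g` preserves the elements with untilt `1`, then `W(g)` preserves the kernel of `θ`: since
`untilt (g e)` is a primitive `p`-th root of unity, `W(g)` maps the generator
`1 + [e] + ⋯ + [e]ᵖ⁻¹` into the kernel. -/
lemma fontaineTheta_map_eq_zero [IsDomain A] [NeZero (p : A)]
    (hA : ∀ a b : A, b ^ p ∣ a ^ p → b ∣ a) {e : Perfection A p}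
    (he : IsPrimitiveRoot (Perfection.coeffMonoidHom A p 1 e) (p ^ 2))
    {g : PreTilt A p →+* PreTilt A p} (hg : ∀ r, (g r).untilt = 1 ↔ r.untilt = 1)
    {x : WittVector p (PreTilt A p)} (hx : fontaineTheta A p x = 0) :
    fontaineTheta A p (WittVector.map g x) = 0 := by
  have he0 : IsPrimitiveRoot (PreTilt.untilt (sharpEquiv e)) p := by
    rw [untilt_sharpEquiv, ← Perfection.coeffMonoidHom_pow_p' e 0]
    exact he.pow (pow_pos (Fact.out : p.Prime).pos _) (sq p)
  have hz : ∑ i ∈ Finset.range p, (g (sharpEquiv e)).untilt ^ i = 0 := by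
    refine IsPrimitiveRoot.geom_sum_eq_zero ?_ (Fact.out : p.Prime).one_lt
    rw [IsPrimitiveRoot.iff_orderOf]
    refine orderOf_eq_prime ?_ ?_
    · rw [← map_pow, ← map_pow, hg, map_pow, he0.pow_eq_one]
    · rw [Ne, hg]
      exact he0.ne_one (Fact.out : p.Prime).one_lt
  refine eq_of_forall_pow_dvd_sub (p := p) fun n => ?_
  rw [sub_zero]
  induction n generalizing x with
  | zero => simp
  | succ n ih =>
    obtain ⟨y, x', rfl⟩ := exists_eq_of_fontaineTheta_eq_zero hA he hx
    have hgen : ∀ f : PreTilt A p →+* PreTilt A p, fontaineTheta A p (WittVector.map f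
        ((∑ i ∈ Finset.range p, teichmuller p (sharpEquiv e) ^ i) * y + p * x')) =
        (∑ i ∈ Finset.range p, (f (sharpEquiv e)).untilt ^ i) *
          fontaineTheta A p (WittVector.map f y) + p * fontaineTheta A p (WittVector.map f x') := by
      intro f
      simp only [map_add, map_mul, map_sum, map_pow, map_natCast, map_teichmuller,
        fontaineTheta_teichmuller]
    have hx' : fontaineTheta A p x' = 0 := by
      simp only [map_add, map_mul, map_sum, map_pow, map_natCast, fontaineTheta_teichmuller] at hx
      rw [he0.geom_sum_eq_zero (Fact.out : p.Prime).one_lt, zero_mul, zero_add] at hx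
      exact (mul_eq_zero.1 hx).resolve_left (NeZero.ne _)
    rw [hgen, hz, zero_mul, zero_add, pow_succ']
    exact mul_dvd_mul_left _ (ih hx')

/-! ### Automorphisms of `A` and of its tilt -/

lemma untilt_preTiltMap (f : A ≃+* A) (r : PreTilt A p) :
    (preTiltMap A f r).untilt = f r.untilt := by
  obtain ⟨a, rfl⟩ := sharpEquiv.surjective r
  have h1 : preTiltMap A f (sharpEquiv a) =
      sharpEquiv (Perfection.mapMonoidHom p (f : A →* A) a) :=
    Perfection.ext fun n => rfl
  rw [h1, untilt_sharpEquiv, untilt_sharpEquiv]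
  rfl

lemma eq_one_of_preTiltMap_eq (hF : Function.Surjective (frobenius (ModP A p) p)) {f : A ≃+* A}
    (hf : ∀ r : PreTilt A p, preTiltMap A f r = r) : f = 1 := by
  have h1 : (f : A →+* A).comp (fontaineTheta A p) = fontaineTheta A p :=
    ringHom_eq_of_apply_teichmuller_eq fun r => by
      rw [RingHom.comp_apply, fontaineTheta_teichmuller, RingEquiv.coe_toRingHom,
        ← untilt_preTiltMap, hf]
  refine RingEquiv.ext fun a => ?_
  obtain ⟨x, rfl⟩ := surjective_fontaineTheta hF a
  exact RingHom.congr_fun h1 x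

/-- An automorphism of the tilt is determined by its effect on untilts. -/
lemma preTiltMap_eq_of_untilt {f : A ≃+* A} {g : PreTilt A p →+* PreTilt A p}
    (h : ∀ r, f r.untilt = (g r).untilt) (r : PreTilt A p) : preTiltMap A f r = g r := by
  refine Perfection.ext fun n => ?_
  have h1 : ∀ s : PreTilt A p, PreTilt.coeff n s =
      PreTilt.coeff 0 ((frobeniusEquiv (PreTilt A p) p).symm^[n] s) := fun s => by
    rw [PreTilt.coeff_iterate_frobeniusEquiv_symm, zero_add]
  have h2 : ∀ φ : PreTilt A p →+* PreTilt A p, PreTilt.coeff n (φ r) =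
      PreTilt.coeff 0 (φ ((frobeniusEquiv (PreTilt A p) p).symm^[n] r)) := fun φ => by
    rw [h1, φ.map_iterate_frobeniusEquiv_symm p]
  change PreTilt.coeff n (preTiltMap A f r) = PreTilt.coeff n (g r)
  rw [h2, h2, ← PreTilt.mk_untilt_eq_coeff_zero, ← PreTilt.mk_untilt_eq_coeff_zero,
    untilt_preTiltMap, h]

/-- An automorphism of the tilt which preserves the elements with untilt `1` comes from an
automorphism of `A`, namely the one that it induces on `A = W(A♭) / ker θ`. -/
lemma exists_preTiltMap_eq [IsDomain A] [NeZero (p : A)]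
    (hA : ∀ a b : A, b ^ p ∣ a ^ p → b ∣ a)
    (hF : Function.Surjective (frobenius (ModP A p) p)) {e : Perfection A p}
    (he : IsPrimitiveRoot (Perfection.coeffMonoidHom A p 1 e) (p ^ 2))
    (g : PreTilt A p ≃+* PreTilt A p) (hg : ∀ r, (g r).untilt = 1 ↔ r.untilt = 1) :
    ∃ f : A ≃+* A, ∀ r, preTiltMap A f r = g r := by
  have hsurj := surjective_fontaineTheta hF
  have key : ∀ g : PreTilt A p ≃+* PreTilt A p, (∀ r, (g r).untilt = 1 ↔ r.untilt = 1) →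
      ∃ f : A →+* A, ∀ x, f (fontaineTheta A p x) =
        fontaineTheta A p (WittVector.map (g : PreTilt A p →+* PreTilt A p) x) := by
    intro g hg
    refine ⟨RingHom.liftOfSurjective (fontaineTheta A p) hsurj
      ⟨(fontaineTheta A p).comp (WittVector.map (g : PreTilt A p →+* PreTilt A p)), ?_⟩,
      fun x => RingHom.liftOfSurjective_comp_apply ..⟩
    intro x hx
    exact fontaineTheta_map_eq_zero hA he hg hx
  obtain ⟨f, hf⟩ := key g hg
  obtain ⟨f', hf'⟩ := key g.symm fun r => by rw [← hg, RingEquiv.apply_symm_apply]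
  refine ⟨RingEquiv.ofRingHom f f' ?_ ?_, preTiltMap_eq_of_untilt
    (g := (g : PreTilt A p →+* PreTilt A p)) fun r => ?_⟩
  · refine RingHom.ext fun a => ?_
    obtain ⟨x, rfl⟩ := hsurj a
    rw [RingHom.comp_apply, hf', hf]
    exact congrArg _ (WittVector.ext fun n => by simp [WittVector.map_coeff])
  · refine RingHom.ext fun a => ?_
    obtain ⟨x, rfl⟩ := hsurj a
    rw [RingHom.comp_apply, hf, hf']
    exact congrArg _ (WittVector.ext fun n => by simp [WittVector.map_coeff])
  · have h1 := hf (teichmuller p r)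
    rwa [fontaineTheta_teichmuller, map_teichmuller, fontaineTheta_teichmuller] at h1

end General

/-! ### The group `⟨ε⟩` -/

section Fontaine
variable {p : ℕ} [Fact p.Prime] {d : ℕ}

namespace FontaineElement
variable (ε : FontaineElement p d)

/-- The sequence `(ε⁽ⁿ⁾)ₙ` as an element of the limit of copies of `𝒪_{ℂ(N)_p}` along the `p`-th
power maps. -/
def seq : Perfection (CField.integers p d) p := ⟨ε.root, ε.root_succ_pow⟩

lemma root_add_pow (m n : ℕ) : ε.root (m + n) ^ p ^ n = ε.root m :=
  Perfection.coeffMonoidHom_pow_p_pow' ε.seq m n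

lemma isPrimitiveRoot_root (n : ℕ) : IsPrimitiveRoot (ε.root n) (p ^ n) := by
  cases n with
  | zero => simp [ε.root_zero]
  | succ n =>
    rw [IsPrimitiveRoot.iff_orderOf]
    refine orderOf_eq_prime_pow ?_ (ε.root_pow _)
    rw [add_comm, ε.root_add_pow]
    exact ε.root_one_ne

lemma root_pow_eq_root_pow_iff {n i j : ℕ} :
    ε.root n ^ i = ε.root n ^ j ↔ i ≡ j [MOD p ^ n] := by
  have h1 : IsOfFinOrder (ε.root n) := isOfFinOrder_iff_pow_eq_one.2
    ⟨p ^ n, pow_pos (Fact.out : p.Prime).pos n, ε.root_pow n⟩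
  rw [h1.pow_eq_pow_iff_modEq, ← (ε.isPrimitiveRoot_root n).eq_orderOf]

/-- A compatible sequence of residues modulo the powers of `p` comes from a `p`-adic integer. -/
lemma exists_forall_appr_modEq {k : ℕ → ℕ} (hk : ∀ m n, k (m + n) ≡ k m [MOD p ^ m]) :
    ∃ a : ℤ_[p], ∀ n, a.appr n ≡ k n [MOD p ^ n] := by
  have hc : IsAdicComplete (Ideal.span {(p : ℤ_[p])}) ℤ_[p] := (Stage.base p).complete
  have hmod : ∀ {n : ℕ} {x y : ℤ_[p]},
      x ≡ y [SMOD (Ideal.span {(p : ℤ_[p])} ^ n • ⊤ : Submodule ℤ_[p] ℤ_[p])] ↔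
        PadicInt.toZModPow n x = PadicInt.toZModPow n y := fun {n x y} => by
    rw [SModEq.sub_mem, smul_eq_mul, Ideal.mul_top, Ideal.span_singleton_pow,
      ← PadicInt.ker_toZModPow, RingHom.mem_ker, map_sub, sub_eq_zero]
  obtain ⟨a, ha⟩ := IsPrecomplete.prec (I := Ideal.span {(p : ℤ_[p])}) inferInstance
    (f := fun n => (k n : ℤ_[p])) (fun {m n} hmn => by
      obtain ⟨j, rfl⟩ := Nat.exists_eq_add_of_le hmn
      rw [hmod, map_natCast, map_natCast, ZMod.natCast_eq_natCast_iff]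
      exact (hk m j).symm)
  refine ⟨a, fun n => ?_⟩
  have h1 := hmod.1 (ha n)
  rw [map_natCast] at h1
  rw [← ZMod.natCast_eq_natCast_iff, h1]
  rfl

/-- The group `⟨ε⟩` consists of the elements of `R(N)` with untilt `1`; in particular it does not
depend on `ε`. -/
lemma exists_zpPow_eq_iff {x : RRing p d} : (∃ a, ε.zpPow a = x) ↔ PreTilt.untilt x = 1 := by
  have hz : ∀ a, ∃ s : Perfection (CField.integers p d) p, ε.zpPow a = sharpEquiv s ∧
      ∀ n, Perfection.coeffMonoidHom _ p n s = ε.root n ^ a.appr n := fun a =>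
    ⟨⟨fun n => ε.root n ^ a.appr n, fun n => by
      rw [pow_right_comm, ε.root_succ_pow, root_pow_eq_root_pow_iff]
      obtain ⟨c, hc⟩ := PadicInt.dvd_appr_sub_appr a n (n + 1) n.le_succ
      exact ((Nat.modEq_iff_dvd' (PadicInt.appr_mono a n.le_succ)).2 ⟨c, hc⟩).symm⟩,
      rfl, fun n => rfl⟩
  constructor
  · rintro ⟨a, rfl⟩
    obtain ⟨s, hs, hsn⟩ := hz a
    rw [hs, untilt_sharpEquiv, hsn, ε.root_zero, one_pow]
  · intro hx
    obtain ⟨s, rfl⟩ := sharpEquiv.surjective x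
    rw [untilt_sharpEquiv] at hx
    have hk : ∀ n, ∃ k, ε.root n ^ k = Perfection.coeffMonoidHom _ p n s := fun n => by
      have : NeZero (p ^ n) := ⟨(pow_pos (Fact.out : p.Prime).pos n).ne'⟩
      obtain ⟨k, -, hk⟩ := (ε.isPrimitiveRoot_root n).eq_pow_of_pow_eq_one
        (ξ := Perfection.coeffMonoidHom _ p n s)
        (by rw [Perfection.coeffMonoidHom_pow_p_pow_self, hx])
      exact ⟨k, hk⟩
    choose k hk using hk
    obtain ⟨a, ha⟩ := exists_forall_appr_modEq (p := p) (k := k) fun m n => by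
      rw [← ε.root_pow_eq_root_pow_iff, hk m, ← Perfection.coeffMonoidHom_pow_p_pow' s m n,
        ← hk (m + n), pow_right_comm, ε.root_add_pow]
    obtain ⟨s', hs', hsn'⟩ := hz a
    refine ⟨a, hs'.trans (congrArg _ (Perfection.extMonoid fun n => ?_))⟩
    rw [hsn', ← hk, root_pow_eq_root_pow_iff]
    exact ha n

lemma algebraMap_mem_group_iff {x : RRing p d} :
    algebraMap (RRing p d) (RField p d) x ∈ ε.group ↔ PreTilt.untilt x = 1 := by
  rw [← ε.exists_zpPow_eq_iff]
  exact ⟨fun ⟨a, ha⟩ => ⟨a, IsFractionRing.injective (RRing p d) (RField p d) ha⟩,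
    fun ⟨a, ha⟩ => ⟨a, congrArg _ ha⟩⟩

/-- An automorphism `h` of `R₀(N)` that restricts to `g` on `R(N)` stabilizes `⟨ε⟩` if and only if
`g` preserves the elements with untilt `1`. -/
lemma image_group_eq_iff {h : RField p d ≃+* RField p d} {g : RRing p d ≃+* RRing p d}
    (hg : ∀ r, h (algebraMap _ (RField p d) r) = algebraMap _ (RField p d) (g r)) :
    h '' ε.group = ε.group ↔ ∀ r, PreTilt.untilt (g r) = 1 ↔ PreTilt.untilt r = 1 := by
  have hrange : ∀ y ∈ ε.group, ∃ r, algebraMap (RRing p d) (RField p d) r = y := by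
    rintro _ ⟨a, rfl⟩
    exact ⟨_, rfl⟩
  constructor
  · intro hh r
    rw [← ε.algebraMap_mem_group_iff, ← ε.algebraMap_mem_group_iff, ← hg]
    conv_lhs => rw [← hh]
    exact h.injective.mem_set_image
  · intro hr
    refine Set.Subset.antisymm ?_ fun y hy => ?_
    · rintro _ ⟨y, hy, rfl⟩
      obtain ⟨r, rfl⟩ := hrange y hy
      rwa [hg, ε.algebraMap_mem_group_iff, hr, ← ε.algebraMap_mem_group_iff]
    · obtain ⟨r, rfl⟩ := hrange y hy
      refine ⟨algebraMap _ _ (g.symm r), ?_, by rw [hg, RingEquiv.apply_symm_apply]⟩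
      rwa [ε.algebraMap_mem_group_iff, ← hr, RingEquiv.apply_symm_apply,
        ← ε.algebraMap_mem_group_iff]

end FontaineElement

/-! ### The correspondence `f ↦ f_R` -/

lemma exists_ringEquiv_of_mem_autR {h : RField p d ≃+* RField p d} (hh : h ∈ AutR p d) :
    ∃ g : RRing p d ≃+* RRing p d,
      ∀ r, h (algebraMap _ (RField p d) r) = algebraMap _ (RField p d) (g r) := by
  let i : RRing p d ≃+* (algebraMap (RRing p d) (RField p d)).range :=
    RingEquiv.ofBijective (algebraMap (RRing p d) (RField p d)).rangeRestrict
      ⟨fun x y hxy => IsFractionRing.injective (RRing p d) (RField p d) (congrArg Subtype.val hxy),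
        RingHom.rangeRestrict_surjective _⟩
  have hi : ∀ r, ((i r : (algebraMap (RRing p d) (RField p d)).range) : RField p d) =
      algebraMap _ _ r := fun r => rfl
  refine ⟨(i.trans (autRestrict _ ⟨h, hh⟩)).trans i.symm, fun r => ?_⟩
  rw [← hi (RingEquiv.trans _ _ r)]
  simp only [RingEquiv.coe_trans, Function.comp_apply, RingEquiv.apply_symm_apply]
  rfl

lemma ringEquiv_eq_of_forall_algebraMap {h h' : RField p d ≃+* RField p d}
    (hh : ∀ r, h (algebraMap (RRing p d) _ r) = h' (algebraMap _ _ r)) : h = h' := by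
  have h1 : (h : RField p d →+* RField p d) = h' :=
    IsLocalization.ringHom_ext (nonZeroDivisors (RRing p d)) (RingHom.ext hh)
  exact RingEquiv.ext (RingHom.congr_fun h1)

/-- An automorphism of `𝒪_{ℂ(N)_p}` extends to its fraction field `ℂ(N)_p`. -/
lemma autRestrict_surjective : Function.Surjective (autRestrict (CField.integers p d)) := by
  intro f
  let F : CField p d ≃+* CField p d := IsFractionRing.ringEquivOfRingEquiv f
  have hF : ∀ a : CField.integers p d, F a = f a := fun a =>
    IsFractionRing.ringEquivOfRingEquiv_algebraMap f a
  have hF' : ∀ a : CField.integers p d, F.symm a = f.symm a := fun a => by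
    rw [RingEquiv.symm_apply_eq, hF, RingEquiv.apply_symm_apply]
  refine ⟨⟨F, fun x => ⟨fun hx => ?_, fun hx => ?_⟩⟩, RingEquiv.ext fun a => Subtype.ext (hF a)⟩
  · have h1 := hF' ⟨F x, hx⟩
    rw [RingEquiv.symm_apply_apply] at h1
    rw [h1]
    exact (f.symm _).2
  · have h1 := hF ⟨x, hx⟩
    rw [h1]
    exact (f _).2

lemma autRestrict_injective : Function.Injective (autRestrict (CField.integers p d)) := by
  intro f f' hff'
  refine Subtype.ext (RingEquiv.ext fun x => ?_)
  have h1 : (f.1 : CField p d →+* CField p d) = f'.1 :=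
    IsLocalization.ringHom_ext (nonZeroDivisors (CField.integers p d)) (RingHom.ext fun a =>
      congrArg Subtype.val (RingEquiv.congr_fun hff' a))
  exact RingHom.congr_fun h1 x

lemma inducedAut_injective : Function.Injective (inducedAut p d) := by
  rw [injective_iff_map_eq_one]
  intro f hf
  refine (injective_iff_map_eq_one _).1 autRestrict_injective f
    (eq_one_of_preTiltMap_eq (CField.frobenius_modP_surjective p d) fun r => ?_)
  apply IsFractionRing.injective (RRing p d) (RField p d)
  rw [← inducedAut_algebraMap, hf]
  rfl

lemma inducedAut_mem_autStabilizing (ε : FontaineElement p d) (f : AutC p d) :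
    inducedAut p d f ∈ ε.autStabilizing := by
  let g : RRing p d ≃+* RRing p d :=
    preTiltAut (CField.integers p d) (autRestrict (CField.integers p d) f)
  have hg : ∀ r, inducedAut p d f (algebraMap _ (RField p d) r) =
      algebraMap _ (RField p d) (g r) := inducedAut_algebraMap p d f
  refine ⟨fun x => ⟨?_, ?_⟩, (ε.image_group_eq_iff hg).2 fun r => ?_⟩
  · rintro ⟨r, hr⟩
    refine ⟨g.symm r, (inducedAut p d f).injective ?_⟩
    rw [hg, RingEquiv.apply_symm_apply, hr]
  · rintro ⟨r, rfl⟩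
    exact ⟨g r, (hg r).symm⟩
  · have h1 : PreTilt.untilt (g r) = autRestrict (CField.integers p d) f (PreTilt.untilt r) :=
      untilt_preTiltMap _ r
    rw [h1, EmbeddingLike.map_eq_one_iff]

lemma exists_inducedAut_eq (ε : FontaineElement p d) {h : RField p d ≃+* RField p d}
    (hh : h ∈ ε.autStabilizing) : ∃ f, inducedAut p d f = h := by
  obtain ⟨g, hg⟩ := exists_ringEquiv_of_mem_autR hh.1
  -- The sequence `ε^{1/p} = (ε⁽ⁿ⁺¹⁾)ₙ`.
  let e : Perfection (CField.integers p d) p :=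
    ⟨fun n => ε.root (n + 1), fun n => ε.root_succ_pow (n + 1)⟩
  obtain ⟨f₀, hf₀⟩ := exists_preTiltMap_eq
    (fun _ _ => CField.dvd_of_pow_dvd_pow p d (Fact.out : p.Prime).pos)
    (CField.frobenius_modP_surjective p d) (e := e) (ε.isPrimitiveRoot_root 2) g
    ((ε.image_group_eq_iff hg).1 hh.2)
  obtain ⟨f, rfl⟩ := autRestrict_surjective f₀
  refine ⟨f, ringEquiv_eq_of_forall_algebraMap fun r => ?_⟩
  rw [inducedAut_algebraMap, hf₀, hg]

end Fontaine

end HigherLocal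

end

theorem lemma7p4 (p : ℕ) [Fact p.Prime] (d : ℕ) (ε : HigherLocal.FontaineElement p d) :
    Function.Injective (HigherLocal.inducedAut p d) ∧
      (HigherLocal.inducedAut p d).range = ε.autStabilizing := by
  refine ⟨HigherLocal.inducedAut_injective, Subgroup.ext fun h => ⟨?_, ?_⟩⟩
  · rintro ⟨f, rfl⟩
    exact HigherLocal.inducedAut_mem_autStabilizing ε f
  · exact HigherLocal.exists_inducedAut_eq ε
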